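/- Let $\rho,\sigma$ be $d$-dimensional quantum states, i.e. positive semidefinite complex $d\times d$ matrices of trace $1$. Let $d\psi$ denote the uniform (unitarily invariant) probability measure on the unit vectors $|\psi\rangle$ of $\mathbb{C}^d$, and let $\|X\|_2=\left(\sum_i|\lambda_i(X)|^2\right)^{1/2}$ be the Schatten $2$-norm of a Hermitian matrix $X$ with eigenvalues $\lambda_i(X)$. Then \[ \frac13\,\|\rho-\sigma\|_2 \;\le\; d\int |\langle\psi|(\rho-\sigma)|\psi\rangle|\,d\psi \;\le\; \|\rho-\sigma\|_2 . \] -/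

import Mathlib

open MeasureTheory Matrix
open scoped ComplexOrder

/-- A `d`-dimensional (mixed) quantum state: a positive semidefinite complex matrix of trace `1`. -/
structure IsQuantumState {d : ℕ} (ρ : Matrix (Fin d) (Fin d) ℂ) : Prop where
  posSemidef : ρ.PosSemidef
  trace_eq_one : ρ.trace = 1

/-- The difference of two quantum states is Hermitian. -/
theorem IsQuantumState.isHermitian_sub {d : ℕ} {ρ σ : Matrix (Fin d) (Fin d) ℂ}
    (hρ : IsQuantumState ρ) (hσ : IsQuantumState σ) : (ρ - σ).IsHermitian :=
  hρ.posSemidef.isHermitian.sub hσ.posSemidef.isHermitian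

/-- The Schatten `p`-norm `(∑ᵢ |λᵢ(X)|ᵖ)^(1/p)` of a Hermitian matrix `X`, where the `λᵢ(X)` are
the eigenvalues of `X` counted with multiplicity. -/
noncomputable def schattenNorm {d : ℕ} (p : ℝ) {X : Matrix (Fin d) (Fin d) ℂ}
    (hX : X.IsHermitian) : ℝ :=
  (∑ i, |hX.eigenvalues i| ^ p) ^ (1 / p)

/-- The uniform probability measure `dψ` on the unit vectors `ψ` of `ℂᵈ` (for `0 < d`): the surface
measure on the unit sphere of `ℂᵈ`, normalised to total mass `1`. -/
noncomputable def uniformPureState (d : ℕ) :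
    Measure (Metric.sphere (0 : EuclideanSpace ℂ (Fin d)) 1) :=
  ((volume : Measure (EuclideanSpace ℂ (Fin d))).toSphere Set.univ)⁻¹ •
    (volume : Measure (EuclideanSpace ℂ (Fin d))).toSphere

/-- The number `⟨ψ|X|ψ⟩`. -/
noncomputable def expectationValue {d : ℕ} (X : Matrix (Fin d) (Fin d) ℂ)
    (ψ : EuclideanSpace ℂ (Fin d)) : ℂ :=
  star ψ.ofLp ⬝ᵥ (X *ᵥ ψ.ofLp)

/-!
The function `ψ ↦ |⟨ψ|X|ψ⟩|`, with `X = ρ - σ`, is homogeneous of degree `2`. In polar coordinates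
its average over the unit sphere of `ℂ^d` therefore differs from its average over a standard complex
Gaussian vector only by the factor `Γ(d + 1) / Γ(d) = d`, which is exactly the factor in front of the
integral (`card_mul_integral_uniformPureState`). In an eigenbasis of `X` the quantity to be bounded is
thus `E |∑ λᵢ |zᵢ|²|` with independent standard complex Gaussians `zᵢ`
(`card_mul_integral_norm_expectationValue`), and `∑ λᵢ = tr X = 0` allows `|zᵢ|²` to be replaced by
`Yᵢ = |zᵢ|² - 1`.

The `Yᵢ` are centred with `E Yᵢ² = 1` and `E Yᵢ⁴ = 9`, as `|zᵢ|²` is exponentially distributed. Hence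
`S = ∑ λᵢ Yᵢ` satisfies `E S² = ∑ λᵢ² = ‖X‖₂²` and `E S⁴ ≤ 9 ‖X‖₂⁴` (`moments_sum_of_iIndepFun`). The
upper bound is `E |S| ≤ (E S²)^(1/2)`; the lower bound is `E |S| ≥ (E S²)^(3/2) / (E S⁴)^(1/2)`, in the
form `le_integral_abs_of_integral_pow_four_le`.
-/

/-! ### Comparing first, second and fourth moments -/

theorem integral_abs_le_of_integral_sq_eq {Ω : Type*} {m : MeasurableSpace Ω} {μ : Measure Ω}
    [IsProbabilityMeasure μ] {X : Ω → ℝ} {s : ℝ} (hs : 0 < s) (hX : Integrable X μ)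
    (hX2 : Integrable (fun ω ↦ X ω ^ 2) μ) (h2 : ∫ ω, X ω ^ 2 ∂μ = s ^ 2) :
    ∫ ω, |X ω| ∂μ ≤ s := by
  have key : ∫ ω, 2 * s * |X ω| ∂μ ≤ ∫ ω, (s ^ 2 + X ω ^ 2) ∂μ := by
    refine integral_mono (hX.abs.const_mul _) ((integrable_const _).add hX2) fun ω ↦ ?_
    have := sq_nonneg (s - |X ω|)
    have h := sq_abs (X ω)
    simp only
    nlinarith
  rw [integral_const_mul, integral_add (integrable_const _) hX2, h2] at key
  simp only [integral_const, probReal_univ, one_smul] at key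
  nlinarith

/-- A lower bound for the first absolute moment in terms of the second and fourth moments (an
instance of the "fourth moment method"). -/
theorem le_integral_abs_of_integral_pow_four_le {Ω : Type*} {m : MeasurableSpace Ω}
    {μ : Measure Ω} {X : Ω → ℝ} {s : ℝ} (hs : 0 < s) (hX : Integrable X μ)
    (hX2 : Integrable (fun ω ↦ X ω ^ 2) μ) (hX4 : Integrable (fun ω ↦ X ω ^ 4) μ)
    (h2 : ∫ ω, X ω ^ 2 ∂μ = s ^ 2) (h4 : ∫ ω, X ω ^ 4 ∂μ ≤ 9 * (s ^ 2) ^ 2) :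
    s / 3 ≤ ∫ ω, |X ω| ∂μ := by
  -- With `u = |X| / (3 s)` the integrand inequality reads `u (u - 1) ^ 2 (u + 2) ≥ 0`; the
  -- zeros `|X| = 0` and `|X| = 3 s` are the values of `|X|` for which Hölder's inequality
  -- `(E X²)³ ≤ (E |X|)² E X⁴` is sharp when `E X² = s²` and `E X⁴ = 9 s⁴`.
  have key : ∫ ω, (27 * s ^ 2 * X ω ^ 2 - X ω ^ 4) ∂μ ≤ ∫ ω, 54 * s ^ 3 * |X ω| ∂μ := by
    refine integral_mono ((hX2.const_mul _).sub hX4) (hX.abs.const_mul _) fun ω ↦ ?_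
    have h : 0 ≤ |X ω| * (|X ω| - 3 * s) ^ 2 * (|X ω| + 6 * s) := by positivity
    have h2 := sq_abs (X ω)
    have h4 : |X ω| ^ 4 = X ω ^ 4 := by rw [show 4 = 2 * 2 by rfl, pow_mul, pow_mul, h2]
    simp only
    rw [← h2, ← h4]
    nlinarith
  rw [integral_sub (hX2.const_mul _) hX4, integral_const_mul, integral_const_mul, h2] at key
  have h : 18 * s ^ 3 * s ≤ 54 * s ^ 3 * ∫ ω, |X ω| ∂μ := by nlinarith
  have h3 : 0 < 54 * s ^ 3 := by positivity
  rw [← mul_le_mul_iff_of_pos_left h3]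
  linarith

/-! ### Moments of linear combinations of independent centred variables -/

theorem MeasureTheory.MemLp.integrable_pow_of_le {Ω : Type*} {m : MeasurableSpace Ω}
    {μ : Measure Ω} [IsFiniteMeasure μ] {X : Ω → ℝ} {n k : ℕ} (hX : MemLp X n μ) (hk : k ≤ n) :
    Integrable (fun ω ↦ X ω ^ k) μ := by
  rcases Nat.eq_zero_or_pos k with rfl | hk0
  · simp
  have h : MemLp X k μ := hX.mono_exponent (by exact_mod_cast hk)
  refine (integrable_norm_iff (h.aestronglyMeasurable.pow k)).1 ?_
  simpa [norm_pow] using h.integrable_norm_pow hk0.ne'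

open ProbabilityTheory in
/-- If the `Y i` are independent and centred with unit variance and fourth moment at most `9`, the
fourth moment of `∑ a i * Y i` is at most `9` times the square of its variance. The constant survives
adding a summand because `9 p² + 6 a² p + 9 a⁴ ≤ 9 (p + a²)²`. -/
theorem moments_sum_of_iIndepFun {Ω ι : Type*} {m : MeasurableSpace Ω} {μ : Measure Ω}
    [IsProbabilityMeasure μ] {Y : ι → Ω → ℝ} (hind : iIndepFun Y μ)
    (hmeas : ∀ i, Measurable (Y i)) (hL : ∀ i, MemLp (Y i) (4 : ℕ) μ)
    (h1 : ∀ i, ∫ ω, Y i ω ∂μ = 0) (h2 : ∀ i, ∫ ω, Y i ω ^ 2 ∂μ = 1)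
    (h4 : ∀ i, ∫ ω, Y i ω ^ 4 ∂μ ≤ 9) (a : ι → ℝ) (s : Finset ι) :
    ∫ ω, ∑ i ∈ s, a i * Y i ω ∂μ = 0 ∧
      ∫ ω, (∑ i ∈ s, a i * Y i ω) ^ 2 ∂μ = ∑ i ∈ s, a i ^ 2 ∧
      ∫ ω, (∑ i ∈ s, a i * Y i ω) ^ 4 ∂μ ≤ 9 * (∑ i ∈ s, a i ^ 2) ^ 2 := by
  classical
  induction s using Finset.induction_on with
  | empty => simp
  | insert i s hi ih =>
    obtain ⟨ih1, ih2, ih4⟩ := ih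
    set S : Ω → ℝ := fun ω ↦ ∑ j ∈ s, a j * Y j ω with hS
    have hSL : MemLp S (4 : ℕ) μ := memLp_finsetSum s fun j _ ↦ (hL j).const_mul (a j)
    have hSmeas : Measurable S := by fun_prop
    have hSY : S ⟂ᵢ[μ] Y i := by
      -- The family equal to `Y i` at `i` and to `a j * Y j` elsewhere is independent; leaving
      -- `Y i` unscaled covers the case `a i = 0`.
      have h := (hind.comp (fun j y ↦ if j = i then y else a j * y) fun j ↦ by
        split_ifs
        exacts [measurable_id, measurable_const_mul _]).indepFun_finsetSum_of_notMem
          (fun j ↦ by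
            by_cases hj : j = i
            · simpa [hj, Function.comp_def] using hmeas i
            · simpa [hj, Function.comp_def] using (hmeas j).const_mul (a j)) hi
      convert! h using 1
      · ext ω
        rw [hS, Finset.sum_apply]
        refine Finset.sum_congr rfl fun j hj ↦ ?_
        have : j ≠ i := fun h ↦ hi (h ▸ hj)
        simp [this]
      · ext ω
        simp
    have hSp : ∀ k ≤ 4, Integrable (fun ω ↦ S ω ^ k) μ := fun k hk ↦ hSL.integrable_pow_of_le hk
    have hYp : ∀ k ≤ 4, Integrable (fun ω ↦ Y i ω ^ k) μ :=
      fun k hk ↦ (hL i).integrable_pow_of_le hk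
    have hpow : ∀ k l : ℕ, (fun ω ↦ S ω ^ k) ⟂ᵢ[μ] (fun ω ↦ Y i ω ^ l) := fun k l ↦
      hSY.comp (measurable_id.pow_const k) (measurable_id.pow_const l)
    have hint : ∀ k l : ℕ, k ≤ 4 → l ≤ 4 → Integrable (fun ω ↦ S ω ^ k * Y i ω ^ l) μ :=
      fun k l hk hl ↦ (hpow k l).integrable_mul (hSp k hk) (hYp l hl)
    have hmul : ∀ k l : ℕ, ∫ ω, S ω ^ k * Y i ω ^ l ∂μ
        = (∫ ω, S ω ^ k ∂μ) * ∫ ω, Y i ω ^ l ∂μ := fun k l ↦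
      (hpow k l).integral_fun_mul_eq_mul_integral (hSmeas.pow_const k).aestronglyMeasurable
        ((hmeas i).pow_const l).aestronglyMeasurable
    have hSi : Integrable S μ := by simpa using hSp 1 (by norm_num)
    have hYi : Integrable (Y i) μ := by simpa using hYp 1 (by norm_num)
    have hsum : ∀ ω, ∑ j ∈ insert i s, a j * Y j ω = a i * Y i ω + S ω := fun ω ↦
      Finset.sum_insert hi
    simp_rw [hsum, Finset.sum_insert hi]
    refine ⟨?_, ?_, ?_⟩
    · rw [integral_add (hYi.const_mul _) hSi, integral_const_mul, h1, ih1]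
      simp
    · have hexp : ∀ ω, (a i * Y i ω + S ω) ^ 2
          = a i ^ 2 * Y i ω ^ 2 + 2 * a i * (S ω ^ 1 * Y i ω ^ 1) + S ω ^ 2 := fun ω ↦ by ring
      simp_rw [hexp]
      rw [integral_add (((hYp 2 (by norm_num)).const_mul _).fun_add
          ((hint 1 1 (by norm_num) (by norm_num)).const_mul _)) (hSp 2 (by norm_num)),
        integral_add ((hYp 2 (by norm_num)).const_mul _)
          ((hint 1 1 (by norm_num) (by norm_num)).const_mul _),
        integral_const_mul, integral_const_mul, hmul, h2, ih2]
      simp [h1]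
    · have hexp : ∀ ω, (a i * Y i ω + S ω) ^ 4
          = a i ^ 4 * Y i ω ^ 4 + 4 * a i ^ 3 * (S ω ^ 1 * Y i ω ^ 3)
            + 6 * a i ^ 2 * (S ω ^ 2 * Y i ω ^ 2) + 4 * a i * (S ω ^ 3 * Y i ω ^ 1)
            + S ω ^ 4 := fun ω ↦ by ring
      simp_rw [hexp]
      have i0 := (hYp 4 le_rfl).const_mul (a i ^ 4)
      have i1 := (hint 1 3 (by norm_num) (by norm_num)).const_mul (4 * a i ^ 3)
      have i2 := (hint 2 2 (by norm_num) (by norm_num)).const_mul (6 * a i ^ 2)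
      have i3 := (hint 3 1 (by norm_num) (by norm_num)).const_mul (4 * a i)
      rw [integral_add (((i0.fun_add i1).fun_add i2).fun_add i3) (hSp 4 le_rfl),
        integral_add ((i0.fun_add i1).fun_add i2) i3, integral_add (i0.fun_add i1) i2,
        integral_add i0 i1,
        integral_const_mul, integral_const_mul, integral_const_mul, integral_const_mul,
        hmul, hmul, hmul, h2, ih2]
      simp only [pow_one, h1, ih1]
      have := mul_le_mul_of_nonneg_left (h4 i) (by positivity : 0 ≤ a i ^ 4)
      nlinarith [mul_nonneg (sq_nonneg (a i)) (Finset.sum_nonneg fun j (_ : j ∈ s) ↦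
        sq_nonneg (a j))]

/-! ### The standard complex Gaussian -/

/-- The standard complex Gaussian distribution, with density `π⁻¹ exp (-|z|²)`; the squared modulus
of such a variable is exponentially distributed with mean `1`. -/
noncomputable def complexGaussian : Measure ℂ :=
  volume.withDensity fun z ↦ ENNReal.ofReal (Real.pi⁻¹ * Real.exp (-‖z‖ ^ 2))

theorem integral_norm_pow_mul_exp_neg_norm_sq (k : ℕ) :
    ∫ z : ℂ, ‖z‖ ^ (2 * k) * Real.exp (-‖z‖ ^ 2) = Real.pi * k.factorial := by
  have h := Complex.integral_rpow_mul_exp_neg_rpow (p := 2) (q := (2 * k : ℕ)) (by norm_num)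
    (by have : (0 : ℝ) ≤ (2 * k : ℕ) := Nat.cast_nonneg _
        linarith)
  simp only [Real.rpow_natCast, Real.rpow_two] at h
  rw [h, show (((2 * k : ℕ) : ℝ) + 2) / 2 = k + 1 by push_cast; ring, Real.Gamma_nat_eq_factorial]
  ring

theorem integrable_norm_pow_mul_exp_neg_norm_sq (k : ℕ) :
    Integrable fun z : ℂ ↦ ‖z‖ ^ (2 * k) * Real.exp (-‖z‖ ^ 2) :=
  .of_integral_ne_zero (by rw [integral_norm_pow_mul_exp_neg_norm_sq]; positivity)

theorem integrable_gaussianDensity :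
    Integrable fun z : ℂ ↦ Real.pi⁻¹ * Real.exp (-‖z‖ ^ 2) := by
  simpa using (integrable_norm_pow_mul_exp_neg_norm_sq 0).const_mul Real.pi⁻¹

theorem integral_complexGaussian (f : ℂ → ℝ) :
    ∫ z, f z ∂complexGaussian = ∫ z, Real.pi⁻¹ * Real.exp (-‖z‖ ^ 2) * f z := by
  rw [complexGaussian, integral_withDensity_eq_integral_toReal_smul (by fun_prop) (by simp)]
  refine integral_congr_ae (.of_forall fun z ↦ ?_)
  simp only [smul_eq_mul]
  rw [ENNReal.toReal_ofReal (by positivity)]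

theorem integral_norm_pow_complexGaussian (k : ℕ) :
    ∫ z, ‖z‖ ^ (2 * k) ∂complexGaussian = k.factorial := by
  rw [integral_complexGaussian]
  simp_rw [mul_assoc]
  rw [integral_const_mul]
  simp_rw [mul_comm (Real.exp _)]
  rw [integral_norm_pow_mul_exp_neg_norm_sq]
  field_simp

theorem integrable_norm_pow_complexGaussian (k : ℕ) :
    Integrable (fun z ↦ ‖z‖ ^ (2 * k)) complexGaussian :=
  .of_integral_ne_zero (by rw [integral_norm_pow_complexGaussian]; positivity)

instance : IsProbabilityMeasure complexGaussian := by
  have h : IsFiniteMeasure complexGaussian := by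
    have := integrable_norm_pow_complexGaussian 0
    simpa [integrable_const_iff] using this
  have := integral_norm_pow_complexGaussian 0
  simp only [mul_zero, pow_zero, integral_const, smul_eq_mul, mul_one, Nat.factorial_zero,
    Nat.cast_one, measureReal_def] at this
  exact ⟨(ENNReal.toReal_eq_one_iff _).1 this⟩

theorem integral_norm_sq_sub_one_complexGaussian :
    ∫ z, (‖z‖ ^ 2 - 1) ∂complexGaussian = 0 := by
  have i1 := integrable_norm_pow_complexGaussian 1
  have m1 := integral_norm_pow_complexGaussian 1
  norm_num at i1 m1
  rw [integral_sub i1 (integrable_const _), m1]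
  simp

theorem integral_norm_sq_sub_one_sq_complexGaussian :
    ∫ z, (‖z‖ ^ 2 - 1) ^ 2 ∂complexGaussian = 1 := by
  have i1 := integrable_norm_pow_complexGaussian 1
  have m1 := integral_norm_pow_complexGaussian 1
  have i2 := integrable_norm_pow_complexGaussian 2
  have m2 := integral_norm_pow_complexGaussian 2
  norm_num [Nat.factorial] at i1 m1 i2 m2
  have h : ∀ z : ℂ, (‖z‖ ^ 2 - 1) ^ 2 = ‖z‖ ^ 4 - 2 * ‖z‖ ^ 2 + 1 := fun z ↦ by ring
  simp_rw [h]
  rw [integral_add (i2.sub' (i1.const_mul _)) (integrable_const _),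
    integral_sub i2 (i1.const_mul _), integral_const_mul, m1, m2]
  norm_num

theorem norm_sq_sub_one_pow_four (z : ℂ) : (‖z‖ ^ 2 - 1) ^ 4
    = ‖z‖ ^ 8 - 4 * ‖z‖ ^ 6 + 6 * ‖z‖ ^ 4 - 4 * ‖z‖ ^ 2 + 1 := by ring

theorem integrable_norm_sq_sub_one_pow_four_complexGaussian :
    Integrable (fun z ↦ (‖z‖ ^ 2 - 1) ^ 4) complexGaussian := by
  simp_rw [norm_sq_sub_one_pow_four]
  exact ((((integrable_norm_pow_complexGaussian 4).sub
    ((integrable_norm_pow_complexGaussian 3).const_mul 4)).add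
    ((integrable_norm_pow_complexGaussian 2).const_mul 6)).sub
    ((integrable_norm_pow_complexGaussian 1).const_mul 4)).add (integrable_const 1)

theorem integral_norm_sq_sub_one_pow_four_complexGaussian :
    ∫ z, (‖z‖ ^ 2 - 1) ^ 4 ∂complexGaussian = 9 := by
  have i1 := (integrable_norm_pow_complexGaussian 1).const_mul 4
  have m1 := integral_norm_pow_complexGaussian 1
  have i2 := (integrable_norm_pow_complexGaussian 2).const_mul 6
  have m2 := integral_norm_pow_complexGaussian 2
  have i3 := (integrable_norm_pow_complexGaussian 3).const_mul 4
  have m3 := integral_norm_pow_complexGaussian 3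
  have i4 := integrable_norm_pow_complexGaussian 4
  have m4 := integral_norm_pow_complexGaussian 4
  norm_num only [Nat.factorial] at i1 m1 i2 m2 i3 m3 i4 m4
  simp_rw [norm_sq_sub_one_pow_four]
  rw [integral_add (((i4.sub' i3).fun_add i2).sub' i1) (integrable_const _),
    integral_sub ((i4.sub' i3).fun_add i2) i1, integral_add (i4.sub' i3) i2, integral_sub i4 i3,
    integral_const_mul, integral_const_mul, integral_const_mul, m1, m2, m3, m4]
  norm_num

theorem memLp_norm_sq_sub_one_complexGaussian :
    MemLp (fun z : ℂ ↦ ‖z‖ ^ 2 - 1) (4 : ℕ) complexGaussian := by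
  have hm : AEStronglyMeasurable (fun z : ℂ ↦ ‖z‖ ^ 2 - 1) complexGaussian :=
    Continuous.aestronglyMeasurable (by fun_prop)
  rw [← integrable_norm_rpow_iff hm (by norm_num) (by simp)]
  refine integrable_norm_sq_sub_one_pow_four_complexGaussian.congr (.of_forall fun z ↦ ?_)
  simp only [ENNReal.toReal_natCast, Real.rpow_natCast]
  rw [Real.norm_eq_abs, Even.pow_abs (by decide)]

/-! ### Product of Gaussians -/

theorem pi_withDensity_ofReal {ι : Type*} [Fintype ι] {E : Type*} {mE : MeasurableSpace E}
    {μ : Measure E} [SigmaFinite μ] {w : E → ℝ} (hw : Integrable w μ) (hw0 : 0 ≤ w) :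
    Measure.pi (fun _ : ι ↦ μ.withDensity fun x ↦ ENNReal.ofReal (w x))
      = (Measure.pi fun _ : ι ↦ μ).withDensity fun x ↦ ENNReal.ofReal (∏ i, w (x i)) := by
  have := hw
  have hfin : IsFiniteMeasure (μ.withDensity fun x ↦ ENNReal.ofReal (w x)) :=
    isFiniteMeasure_withDensity_ofReal hw.2
  refine Measure.pi_eq fun s hs ↦ ?_
  rw [withDensity_apply _ (MeasurableSet.univ_pi hs), Measure.restrict_pi_pi,
    ← ofReal_integral_eq_lintegral_ofReal
      (Integrable.fintype_prod_dep (f := fun _ ↦ w) fun i ↦ hw.restrict)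
      (.of_forall fun x ↦ Finset.prod_nonneg fun i _ ↦ hw0 _),
    integral_fintype_prod_eq_prod (fun _ ↦ w),
    ENNReal.ofReal_prod_of_nonneg fun i _ ↦ integral_nonneg hw0]
  refine Finset.prod_congr rfl fun i _ ↦ ?_
  rw [withDensity_apply _ (hs i), ofReal_integral_eq_lintegral_ofReal hw.restrict (.of_forall hw0)]

theorem integral_pi_complexGaussian {ι : Type*} [Fintype ι] (f : (ι → ℂ) → ℝ) :
    ∫ z, f z ∂(Measure.pi fun _ ↦ complexGaussian)
      = (Real.pi⁻¹) ^ Fintype.card ι * ∫ z : ι → ℂ, f z * Real.exp (-∑ i, ‖z i‖ ^ 2) := by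
  unfold complexGaussian
  rw [pi_withDensity_ofReal integrable_gaussianDensity fun z ↦ by positivity,
    integral_withDensity_eq_integral_toReal_smul (by fun_prop) (by simp), ← integral_const_mul]
  refine integral_congr_ae (.of_forall fun z ↦ ?_)
  simp only [smul_eq_mul]
  rw [ENNReal.toReal_ofReal (Finset.prod_nonneg fun i _ ↦ by positivity), Finset.prod_mul_distrib,
    ← Real.exp_sum, Finset.prod_const, Finset.card_univ, Finset.sum_neg_distrib]
  ring

/-! ### Polar coordinates -/

/-- In polar coordinates, the Gaussian integral of a positively homogeneous function of degree `k`
separates into its integral over the unit sphere and a radial Gamma integral. -/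
theorem integral_mul_exp_neg_norm_sq_of_homogeneous {E : Type*} [NormedAddCommGroup E]
    [NormedSpace ℝ E] [MeasurableSpace E] [BorelSpace E] [FiniteDimensional ℝ E] [Nontrivial E]
    (μ : Measure E) [μ.IsAddHaarMeasure] {f : E → ℝ} (k : ℕ)
    (hf : ∀ r : ℝ, 0 < r → ∀ x, f (r • x) = r ^ k * f x) :
    ∫ x, f x * Real.exp (-‖x‖ ^ 2) ∂μ
      = (∫ x, f x ∂μ.toSphere) * (1 / 2 * Real.Gamma ((Module.finrank ℝ E + k) / 2)) := by
  set n := Module.finrank ℝ E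
  have hn0 : 0 < n := Module.finrank_pos
  have hrad : ∫ r : Set.Ioi (0 : ℝ), (r : ℝ) ^ k * Real.exp (-(r : ℝ) ^ 2)
        ∂Measure.volumeIoiPow (n - 1) = 1 / 2 * Real.Gamma ((n + k) / 2) := by
    have h := integral_rpow_mul_exp_neg_rpow (p := 2) (q := (n - 1 + k : ℕ)) (by norm_num)
      (by have : (0 : ℝ) ≤ (n - 1 + k : ℕ) := Nat.cast_nonneg _
          linarith)
    rw [show (((n - 1 + k : ℕ) : ℝ) + 1) / 2 = (n + k) / 2 by
      push_cast [Nat.cast_sub (Nat.one_le_iff_ne_zero.2 hn0.ne')]; ring] at h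
    rw [← h, Measure.volumeIoiPow, integral_withDensity_eq_integral_toReal_smul
      (by fun_prop) (by simp), integral_subtype_comap measurableSet_Ioi
        fun r : ℝ ↦ (ENNReal.ofReal (r ^ (n - 1))).toReal • (r ^ k * Real.exp (-r ^ 2))]
    refine setIntegral_congr_fun measurableSet_Ioi fun r hr ↦ ?_
    have hr' : 0 < r := hr
    simp only [Real.rpow_natCast, Real.rpow_two, smul_eq_mul]
    rw [ENNReal.toReal_ofReal (by positivity), pow_add]
    ring
  rw [← hrad]
  calc ∫ x, f x * Real.exp (-‖x‖ ^ 2) ∂μ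
      = ∫ x : ({0}ᶜ : Set E), f x * Real.exp (-‖(x : E)‖ ^ 2) ∂(μ.comap (↑)) := by
        rw [integral_subtype_comap (measurableSet_singleton _).compl
          fun x ↦ f x * Real.exp (-‖x‖ ^ 2), restrict_compl_singleton]
    _ = ∫ x : Metric.sphere (0 : E) 1 × Set.Ioi (0 : ℝ),
          f x.1 * ((x.2 : ℝ) ^ k * Real.exp (-(x.2 : ℝ) ^ 2))
          ∂μ.toSphere.prod (.volumeIoiPow (n - 1)) := by
        rw [← μ.measurePreserving_homeomorphUnitSphereProd.integral_comp
          (Homeomorph.measurableEmbedding _)]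
        refine integral_congr_ae (.of_forall fun x ↦ ?_)
        have hx : 0 < ‖(x : E)‖ := norm_pos_iff.2 x.2
        simp only [homeomorphUnitSphereProd_apply_snd_coe, homeomorphUnitSphereProd_apply_fst_coe]
        rw [hf _ (inv_pos.2 hx), inv_pow]
        field_simp
    _ = _ := integral_prod_mul (fun x : Metric.sphere (0 : E) 1 ↦ f x)
          fun r : Set.Ioi (0 : ℝ) ↦ (r : ℝ) ^ k * Real.exp (-(r : ℝ) ^ 2)

/-- The volume of the Hilbert space `ℂ^d` is a multiple of the product of the Lebesgue
measures on the coordinates. The factor is in fact `1`, but this is not needed. -/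
theorem exists_integral_euclideanSpace_eq (d : ℕ) : ∃ c : ℝ, c ≠ 0 ∧
    ∀ g : (Fin d → ℂ) → ℝ, ∫ x : EuclideanSpace ℂ (Fin d), g x.ofLp = c * ∫ z, g z := by
  let L := PiLp.continuousLinearEquiv 2 ℝ fun _ : Fin d ↦ ℂ
  have hH : (Measure.map L (volume : Measure (EuclideanSpace ℂ (Fin d)))).IsAddHaarMeasure :=
    L.isAddHaarMeasure_map _
  set ν := Measure.map L (volume : Measure (EuclideanSpace ℂ (Fin d))) with hν
  refine ⟨(Measure.addHaarScalarFactor ν volume : ℝ), ?_, fun g ↦ ?_⟩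
  · exact_mod_cast (Measure.addHaarScalarFactor_pos_of_isAddHaarMeasure ν volume).ne'
  · have h1 : ∫ z, g z ∂ν = ∫ x : EuclideanSpace ℂ (Fin d), g x.ofLp :=
      L.toHomeomorph.measurableEmbedding.integral_map g
    rw [← h1]
    conv_lhs => rw [Measure.isAddLeftInvariant_eq_smul ν volume]
    rw [integral_smul_nnreal_measure]
    rfl

/-- For a function homogeneous of degree `2`, the average over the unit sphere of `ℂ^d`, scaled by
`d`, is the expectation over a vector of independent standard complex Gaussians. Both sides are
unitarily invariant, so any unitary change of coordinates `U` may be made on the sphere. -/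
theorem card_mul_integral_uniformPureState {d : ℕ} (hd : 0 < d)
    (U : EuclideanSpace ℂ (Fin d) ≃ₗᵢ[ℂ] EuclideanSpace ℂ (Fin d)) {g : (Fin d → ℂ) → ℝ}
    (hg : ∀ r : ℝ, 0 < r → ∀ z, g (r • z) = r ^ 2 * g z) :
    d * ∫ ψ, g (U (ψ : EuclideanSpace ℂ (Fin d))).ofLp ∂(uniformPureState d)
      = ∫ z, g z ∂(Measure.pi fun _ ↦ complexGaussian) := by
  have : Nonempty (Fin d) := ⟨⟨0, hd⟩⟩
  have hdim : (Module.finrank ℝ (EuclideanSpace ℂ (Fin d)) : ℝ) = 2 * d := by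
    have := finrank_real_of_complex (EuclideanSpace ℂ (Fin d))
    rw [this, finrank_euclideanSpace]
    simp
  obtain ⟨c, hc, hcg⟩ := exists_integral_euclideanSpace_eq d
  have hG : ∀ f : (Fin d → ℂ) → ℝ, ∫ x : EuclideanSpace ℂ (Fin d), f x.ofLp * Real.exp (-‖x‖ ^ 2)
      = c * (Real.pi ^ d * ∫ z, f z ∂(Measure.pi fun _ ↦ complexGaussian)) := fun f ↦ by
    rw [integral_pi_complexGaussian, Fintype.card_fin, ← mul_assoc (Real.pi ^ d), ← mul_pow,
      mul_inv_cancel₀ Real.pi_ne_zero, one_pow, one_mul,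
      ← hcg fun z ↦ f z * Real.exp (-∑ i, ‖z i‖ ^ 2)]
    simp_rw [EuclideanSpace.norm_sq_eq]
  have h2 := integral_mul_exp_neg_norm_sq_of_homogeneous 
    (volume : Measure (EuclideanSpace ℂ (Fin d))) (f := fun x ↦ g (U x).ofLp) 2 fun r hr x ↦ by
      rw [← hg r hr, ← WithLp.ofLp_smul 2 r (U x)]
      exact congrArg (fun v : EuclideanSpace ℂ (Fin d) ↦ g v.ofLp)
        (U.toLinearEquiv.toLinearMap.map_smul_of_tower r x)
  have h0 := integral_mul_exp_neg_norm_sq_of_homogeneous 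
    (volume : Measure (EuclideanSpace ℂ (Fin d))) (f := fun _ ↦ 1) 0 fun r hr x ↦ by simp
  have hU : ∫ x : EuclideanSpace ℂ (Fin d), g (U x).ofLp * Real.exp (-‖x‖ ^ 2)
      = ∫ x : EuclideanSpace ℂ (Fin d), g x.ofLp * Real.exp (-‖x‖ ^ 2) := by
    let UR : EuclideanSpace ℂ (Fin d) ≃ₗᵢ[ℝ] EuclideanSpace ℂ (Fin d) :=
      ⟨U.toLinearEquiv.restrictScalars ℝ, U.norm_map⟩
    rw [← UR.measurePreserving.integral_comp UR.toHomeomorph.measurableEmbedding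
      fun x ↦ g x.ofLp * Real.exp (-‖x‖ ^ 2)]
    refine integral_congr_ae (.of_forall fun x ↦ ?_)
    simp only [UR.norm_map]
    rfl
  rw [hU, hG, hdim] at h2
  rw [hG fun _ ↦ 1, hdim] at h0
  have hd' : (d : ℝ) ≠ 0 := by exact_mod_cast hd.ne'
  rw [show (2 * (d : ℝ) + (2 : ℕ)) / 2 = d + 1 by push_cast; ring, Real.Gamma_add_one hd'] at h2
  rw [show (2 * (d : ℝ) + (0 : ℕ)) / 2 = d by push_cast; ring] at h0
  simp only [integral_const, probReal_univ, smul_eq_mul, mul_one] at h0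
  have hΓ : Real.Gamma d ≠ 0 := (Real.Gamma_pos_of_pos (by exact_mod_cast hd)).ne'
  have hcpi : c * Real.pi ^ d ≠ 0 := mul_ne_zero hc (pow_ne_zero _ Real.pi_ne_zero)
  set σ := (volume : Measure (EuclideanSpace ℂ (Fin d))).toSphere with hσ
  have hσ0 : σ.real Set.univ ≠ 0 := fun h ↦ hcpi (by rw [h0, h, zero_mul])
  rw [uniformPureState, integral_smul_measure, ENNReal.toReal_inv, smul_eq_mul,
    ← measureReal_def, ← hσ]
  apply mul_left_cancel₀ hcpi
  rw [mul_assoc c, mul_assoc c, h2, ← mul_assoc c, h0]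
  field_simp

/-! ### Diagonalisation -/

theorem expectationValue_eq_sum_eigenvalues {d : ℕ} {X : Matrix (Fin d) (Fin d) ℂ}
    (hX : X.IsHermitian) (ψ : EuclideanSpace ℂ (Fin d)) :
    expectationValue X ψ
      = ((∑ i, hX.eigenvalues i * ‖hX.eigenvectorBasis.repr ψ i‖ ^ 2 : ℝ) : ℂ) := by
  set b := hX.eigenvectorBasis
  have h : expectationValue X ψ = inner ℂ ψ (WithLp.toLp 2 (X *ᵥ ψ.ofLp)) := by
    rw [expectationValue, EuclideanSpace.inner_eq_star_dotProduct, dotProduct_comm]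
  have h2 : ∀ i, inner ℂ (b i) (WithLp.toLp 2 (X *ᵥ ψ.ofLp))
      = hX.eigenvalues i * inner ℂ (b i) ψ := fun i ↦ by
    rw [EuclideanSpace.inner_eq_star_dotProduct, EuclideanSpace.inner_eq_star_dotProduct,
      dotProduct_comm, dotProduct_mulVec]
    have h3 : star (b i).ofLp ᵥ* X = hX.eigenvalues i • star (b i).ofLp := by
      have := congrArg star (hX.mulVec_eigenvectorBasis i)
      rw [star_mulVec, hX.eq] at this
      rw [this]
      ext j
      simp [b]
    rw [h3, smul_dotProduct, dotProduct_comm]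
    rfl
  rw [h, ← b.sum_inner_mul_inner]
  push_cast
  refine Finset.sum_congr rfl fun i _ ↦ ?_
  rw [h2, b.repr_apply_apply, mul_left_comm, ← Complex.conj_mul', inner_conj_symm]

theorem card_mul_integral_norm_expectationValue {d : ℕ} (hd : 0 < d)
    {X : Matrix (Fin d) (Fin d) ℂ} (hX : X.IsHermitian) :
    d * ∫ ψ, ‖expectationValue X ψ‖ ∂(uniformPureState d)
      = ∫ z, |∑ i, hX.eigenvalues i * ‖z i‖ ^ 2| ∂(Measure.pi fun _ ↦ complexGaussian) := by
  rw [← card_mul_integral_uniformPureState hd hX.eigenvectorBasis.repr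
    (g := fun z ↦ |∑ i, hX.eigenvalues i * ‖z i‖ ^ 2|) fun r hr z ↦ ?_]
  · simp_rw [expectationValue_eq_sum_eigenvalues hX, Complex.norm_real, Real.norm_eq_abs]
  · rw [← abs_of_nonneg (sq_nonneg r), ← abs_mul, Finset.mul_sum]
    simp [mul_pow, mul_left_comm]

/-! ### Bounds for Gaussian averages and for states -/

open ProbabilityTheory in
/-- The Gaussian form of the two bounds: since the coefficients sum to `0`, the exponential
variables `‖z i‖ ^ 2` may be centred, and then the moment bounds apply. -/
theorem integral_abs_sum_complexGaussian_bounds {ι : Type*} [Fintype ι] {a : ι → ℝ}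
    (ha : ∑ i, a i = 0) :
    1 / 3 * √(∑ i, a i ^ 2)
        ≤ ∫ z, |∑ i, a i * ‖z i‖ ^ 2| ∂(Measure.pi fun _ ↦ complexGaussian) ∧
      ∫ z, |∑ i, a i * ‖z i‖ ^ 2| ∂(Measure.pi fun _ ↦ complexGaussian)
        ≤ √(∑ i, a i ^ 2) := by
  have hsq : 0 ≤ ∑ i, a i ^ 2 := Finset.sum_nonneg fun i _ ↦ sq_nonneg _
  rcases hsq.eq_or_lt with h0 | hpos
  · have ha0 : ∀ i, a i = 0 := fun i ↦ by
      have := (Finset.sum_eq_zero_iff_of_nonneg fun i _ ↦ sq_nonneg (a i)).1 h0.symm i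
        (Finset.mem_univ i)
      exact pow_eq_zero_iff two_ne_zero |>.1 this
    simp [ha0]
  set μ : Measure (ι → ℂ) := Measure.pi fun _ ↦ complexGaussian
  let Y : ι → (ι → ℂ) → ℝ := fun i z ↦ ‖z i‖ ^ 2 - 1
  have hind : iIndepFun Y μ :=
    iIndepFun_pi (μ := fun _ : ι ↦ complexGaussian) (X := fun _ z ↦ ‖z‖ ^ 2 - 1)
      fun _ ↦ Measurable.aemeasurable (by fun_prop)
  have hL : ∀ i, MemLp (Y i) (4 : ℕ) μ := fun i ↦
    memLp_norm_sq_sub_one_complexGaussian.comp_measurePreserving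
      (measurePreserving_eval (fun _ : ι ↦ complexGaussian) i)
  have hev : ∀ i (k : ℕ), ∫ z, Y i z ^ k ∂μ = ∫ z, (‖z‖ ^ 2 - 1) ^ k ∂complexGaussian :=
    fun i k ↦ integral_comp_eval (μ := fun _ : ι ↦ complexGaussian)
      (f := fun z : ℂ ↦ (‖z‖ ^ 2 - 1) ^ k) (Continuous.aestronglyMeasurable (by fun_prop))
  obtain ⟨-, h2, h4⟩ := moments_sum_of_iIndepFun hind (fun i ↦ by fun_prop) hL
    (fun i ↦ by simpa [integral_norm_sq_sub_one_complexGaussian] using hev i 1)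
    (fun i ↦ (hev i 2).trans integral_norm_sq_sub_one_sq_complexGaussian)
    (fun i ↦ ((hev i 4).trans integral_norm_sq_sub_one_pow_four_complexGaussian).le)
    a Finset.univ
  have hS : MemLp (fun z ↦ ∑ i, a i * Y i z) (4 : ℕ) μ :=
    memLp_finsetSum _ fun i _ ↦ (hL i).const_mul (a i)
  have hcentre : ∀ z : ι → ℂ, ∑ i, a i * ‖z i‖ ^ 2 = ∑ i, a i * Y i z := fun z ↦ by
    simp [Y, mul_sub, ha]
  simp_rw [hcentre]
  have hs : √(∑ i, a i ^ 2) ^ 2 = ∑ i, a i ^ 2 := Real.sq_sqrt hsq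
  rw [← hs] at h2 h4
  have h1i : Integrable (fun z ↦ ∑ i, a i * Y i z) μ := by
    simpa using hS.integrable_pow_of_le (k := 1) (by norm_num)
  have h2i := hS.integrable_pow_of_le (k := 2) (by norm_num)
  have h4i := hS.integrable_pow_of_le (k := 4) le_rfl
  refine ⟨?_, integral_abs_le_of_integral_sq_eq (Real.sqrt_pos.2 hpos) h1i h2i h2⟩
  rw [one_div_mul_eq_div]
  exact le_integral_abs_of_integral_pow_four_le (Real.sqrt_pos.2 hpos) h1i h2i h4i h2 h4

theorem schattenNorm_two {d : ℕ} {X : Matrix (Fin d) (Fin d) ℂ} (hX : X.IsHermitian) :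
    schattenNorm 2 hX = √(∑ i, hX.eigenvalues i ^ 2) := by
  simp [schattenNorm, Real.sqrt_eq_rpow]

theorem theorem6 {d : ℕ} {ρ σ : Matrix (Fin d) (Fin d) ℂ}
    (hρ : IsQuantumState ρ) (hσ : IsQuantumState σ) :
    1 / 3 * schattenNorm 2 (hρ.isHermitian_sub hσ) ≤
        d * ∫ ψ, ‖expectationValue (ρ - σ) ψ‖ ∂(uniformPureState d) ∧
      d * ∫ ψ, ‖expectationValue (ρ - σ) ψ‖ ∂(uniformPureState d) ≤
        schattenNorm 2 (hρ.isHermitian_sub hσ) := by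
  -- There is no state in dimension `0`, as the trace of the empty matrix is `0`.
  have hd : 0 < d := by
    rcases Nat.eq_zero_or_pos d with rfl | h
    · simpa using hρ.trace_eq_one
    · exact h
  have hX := hρ.isHermitian_sub hσ
  have htr : ∑ i, hX.eigenvalues i = 0 := by
    have h := hX.trace_eq_sum_eigenvalues
    rw [trace_sub, hρ.trace_eq_one, hσ.trace_eq_one, sub_self] at h
    simpa using (congrArg Complex.re h).symm
  rw [card_mul_integral_norm_expectationValue hd hX, schattenNorm_two]
  exact integral_abs_sum_complexGaussian_bounds htr
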